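/- Let $(\Omega,\mathcal A,\mu)$ be a probability space, $T:\Omega\to\Omega$ a measurable map preserving $\mu$ which is mixing, i.e. $\mu(A\cap T^{-n}B)\to\mu(A)\mu(B)$ for all $A,B\in\mathcal A$. Let $\widehat T:\mathcal L^1\to\mathcal L^1$ be its transfer operator, determined by $\int \widehat Tf\cdot g\,d\mu=\int f\cdot (g\circ T)\,d\mu$ for $f\in\mathcal L^1$, $g\in\mathcal L^\infty$. Let $(\mathcal F,\|\cdot\|)$ be a complex Banach algebra of ($\mu$-a.e. classes of) measurable functions $\Omega\to\mathbb C$ with pointwise operations, which contains the constant functions and satisfies $\|f\|\ge |f|_\infty$ for all $f\in\mathcal F$, where $|\cdot|_\infty$ is the essential supremum norm. Assume that $\widehat T$ maps $\mathcal F$ into $\mathcal F$, is bounded with respect to $\|\cdot\|$, and has a spectral gap on $\mathcal F$: $\widehat T|_{\mathcal F}=\lambda P+N$ with $\lambda\in\mathbb C$ and bounded linear operators $P,N$ on $\mathcal F$ such that $P^2=P$, $\dim P(\mathcal F)=1$, $PN=NP=0$, and the spectral radius of $N$ is strictly less than $|\lambda|$. Let $\chi:\Omega\to\mathbb R_{\ge0}$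 be measurable and not $\mu$-almost everywhere equal to $0$. Assume that for all $\ell>0$ the functions $\chi\cdot\mathbf 1_{\{\chi\le\ell\}}$ and $\mathbf 1_{\{\chi>\ell\}}$ belong to $\mathcal F$, and that there are constants $K_1,K_2>0$ such that $$\|\chi\cdot\mathbf 1_{\{\chi\le\ell\}}\|\le K_1\,\ell,\qquad \|\mathbf 1_{\{\chi>\ell\}}\|\le K_2\qquad\text{for all }\ell>0.$$ For $n\in\mathbb N$, $b\in\mathbb N_0$ and $x\in\Omega$ choose a permutation $\sigma$ of $\{0,\dots,n-1\}$ with $\chi(T^{\sigma(0)}x)\ge\chi(T^{\sigma(1)}x)\ge\dots\ge\chi(T^{\sigma(n-1)}x)$ and put $\mathsf S_n^{b}\chi(x)=\sum_{k=b}^{n-1}\chi(T^{\sigma(k)}x)$, the Birkhoff sum without its $b$ largest summands. Then there exist a sequence $(b_n)$ of positive integers with $b_n\to\infty$ and $b_n=o(n)$, and a sequence $(d_n)$ of positive reals, such that $$\lim_{n\to\infty}\frac{\mathsf S_n^{b_n}\chi}{d_n}=1\qquad\mu\text{-almost surely.}$$ -/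

import Mathlib

open MeasureTheory Filter Topology Asymptotics
open scoped ENNReal

noncomputable section

namespace TrimmedBirkhoff

/-- The trimmed Birkhoff sum `S_n^b χ (x)`. Let `σ` be a permutation of `{0, …, n-1}` which puts the
values `χ (T^k x)`, `k < n`, in non-increasing order (here `Tuple.sort` sorts their negatives in
non-decreasing order); then `S_n^b χ (x) = ∑_{k=b}^{n-1} χ (T^{σ(k)} x)`. The value does not depend
on the choice of `σ`, see `trimmedSum_eq`. -/
def trimmedSum {Ω : Type*} (T : Ω → Ω) (χ : Ω → ℝ) (b n : ℕ) (x : Ω) : ℝ :=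
  ∑ k : Fin n with b ≤ k.val,
    χ (T^[(Tuple.sort (fun j : Fin n => -χ (T^[(j : ℕ)] x)) k : ℕ)] x)

/-- Every ordering permutation gives the same trimmed sum. -/
theorem trimmedSum_eq {Ω : Type*} (T : Ω → Ω) (χ : Ω → ℝ) (b n : ℕ) (x : Ω)
    (σ : Equiv.Perm (Fin n)) (hσ : Antitone (fun k : Fin n => χ (T^[(σ k : ℕ)] x))) :
    trimmedSum T χ b n x = ∑ k : Fin n with b ≤ k.val, χ (T^[(σ k : ℕ)] x) := by
  have h := Tuple.unique_monotone (f := fun j : Fin n => -χ (T^[(j : ℕ)] x))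
    (σ := Tuple.sort (fun j : Fin n => -χ (T^[(j : ℕ)] x))) (τ := σ)
    (Tuple.monotone_sort _) (fun i j hij => neg_le_neg (hσ hij))
  refine Finset.sum_congr rfl fun k _ => ?_
  have hk := congrFun h k
  simpa using hk

/-- `h` is the image of `f ∈ L¹` under the transfer operator of `T`: `h` is the (a.e. unique)
integrable function with `∫ h · g dμ = ∫ f · (g ∘ T) dμ` for all `g ∈ L^∞`. -/
def IsTransferImage {Ω : Type*} [MeasurableSpace Ω] (μ : Measure Ω) (T : Ω → Ω)
    (f h : Ω → ℂ) : Prop :=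
  Integrable f μ ∧ Integrable h μ ∧
    ∀ g : Ω → ℂ, MemLp g ∞ μ → ∫ x, h x * g x ∂μ = ∫ x, f x * g (T x) ∂μ

/-- A measure-preserving map is (strongly) mixing: `μ (A ∩ T⁻ⁿ B) → μ A · μ B` for all measurable
sets `A`, `B`. -/
def IsMixing {Ω : Type*} [MeasurableSpace Ω] (μ : Measure Ω) (T : Ω → Ω) : Prop :=
  ∀ A B : Set Ω, MeasurableSet A → MeasurableSet B →
    Tendsto (fun n : ℕ => μ (A ∩ T^[n] ⁻¹' B)) atTop (𝓝 (μ A * μ B))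

/-- A bounded operator `U` on a complex Banach space has a spectral gap: `U = lam • P + N` with
bounded operators `P`, `N`, where `P` is a projection of rank one, the spectral radius of `N` is
strictly less than `|lam|`, and `P N = N P = 0`. -/
def HasSpectralGap {F : Type*} [NormedAddCommGroup F] [NormedSpace ℂ F] (U : F →L[ℂ] F) : Prop :=
  ∃ (lam : ℂ) (P N : F →L[ℂ] F),
    U = lam • P + N ∧
    P ∘L P = P ∧ Module.finrank ℂ (LinearMap.range (P : F →ₗ[ℂ] F)) = 1 ∧
    spectralRadius ℂ N < ‖lam‖ₑ ∧
    P ∘L N = 0 ∧ N ∘L P = 0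

/-- Property C of the system `(Ω, μ, T, F, ‖·‖)`. The complex Banach algebra `F` of (a.e. classes of)
measurable functions is given with the map `ι` that sends an element to the class it is; `ι` is
linear, injective and multiplicative for the pointwise operations, and `ι 1 = 1`, so that `F`
contains the constant functions. The transfer operator maps `F` into itself, is bounded there and has a
spectral gap. -/
structure PropertyC {Ω F : Type*} [MeasurableSpace Ω] (μ : Measure Ω) (T : Ω → Ω)
    [NormedCommRing F] [NormedAlgebra ℂ F] (ι : F →ₗ[ℂ] (Ω →ₘ[μ] ℂ)) : Prop where
  /-- The measure is invariant under `T`. -/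
  measurePreserving : MeasurePreserving T μ μ
  /-- The system is mixing. -/
  mixing : IsMixing μ T
  /-- Elements of `F` are a.e. classes of functions. -/
  injective : Function.Injective ι
  /-- Multiplication in `F` is pointwise multiplication. -/
  map_mul : ∀ f g : F, ι (f * g) = ι f * ι g
  /-- `F` contains the constant functions (the constant `c` is `ι (c • 1)`). -/
  map_one : ι 1 = 1
  /-- The norm dominates the essential supremum norm. -/
  norm_bound : ∀ f : F, eLpNorm (ι f) ∞ μ ≤ ‖f‖ₑ
  /-- The transfer operator restricts to a bounded operator on `F` with a spectral gap. -/
  transfer : ∃ U : F →L[ℂ] F, (∀ f : F, IsTransferImage μ T (ι f) (ι (U f))) ∧ HasSpectralGap U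

/-- Property D of the system `(Ω, μ, T, F, ‖·‖, χ)`: Property C holds, `χ` is measurable and
non-negative, the truncations `χ · 1_{χ ≤ ℓ}` and the indicators `1_{χ > ℓ}`, `ℓ > 0`, belong to
`F`, and their norms are at most `K₁ ℓ` and `K₂`. -/
structure PropertyD {Ω F : Type*} [MeasurableSpace Ω] (μ : Measure Ω) (T : Ω → Ω)
    [NormedCommRing F] [NormedAlgebra ℂ F] (ι : F →ₗ[ℂ] (Ω →ₘ[μ] ℂ)) (χ : Ω → ℝ) : Prop where
  /-- The underlying system has Property C. -/
  propertyC : PropertyC μ T ι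
  /-- The observable is measurable. -/
  measurable : Measurable χ
  /-- The observable is non-negative. -/
  nonneg : ∀ x, 0 ≤ χ x
  /-- The truncations of `χ` grow at most linearly in norm. -/
  truncation : ∃ K₁ : ℝ, 0 < K₁ ∧ ∀ l : ℝ, 0 < l → ∃ f : F,
    (ι f =ᵐ[μ] fun x => ((Set.indicator {y | χ y ≤ l} χ x : ℝ) : ℂ)) ∧ ‖f‖ ≤ K₁ * l
  /-- The indicators of the sets `{χ > l}` are bounded in norm. -/
  indicator : ∃ K₂ : ℝ, 0 < K₂ ∧ ∀ l : ℝ, 0 < l → ∃ f : F,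
    (ι f =ᵐ[μ] Set.indicator {y | l < χ y} (fun _ => (1 : ℂ))) ∧ ‖f‖ ≤ K₂

end TrimmedBirkhoff

end

/-! Mixing makes `T` ergodic. Fix a level `l`. By the pointwise ergodic theorem, about
`n μ(χ > l)` of the first `n` values exceed `l`, and the others add up to about `n m`, where `m` is
the integral of `χ` over `{χ ≤ l}`. Trimming `b ≈ a n` values, with `a` slightly larger than
`μ(χ > l)`, removes all the large values and only `(a - μ(χ > l)) n` others, each at most `l`; so
the trimmed sum is `n m` up to an arbitrarily small relative error, while `a` is small if `l` is
large. A diagonal argument lets the error and `a` tend to zero along `n`. -/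

namespace TrimmedBirkhoff

section ErgodicTheorem

variable {Ω : Type*} {T : Ω → Ω} {f : Ω → ℝ}

theorem bddAbove_range_birkhoffSum_apply_iff (T : Ω → Ω) (f : Ω → ℝ) (x : Ω) :
    BddAbove (Set.range fun n => birkhoffSum T f n (T x)) ↔
      BddAbove (Set.range fun n => birkhoffSum T f n x) := by
  constructor
  · rintro ⟨B, hB⟩
    refine ⟨max 0 (f x + B), ?_⟩
    rintro _ ⟨_ | n, rfl⟩
    · simp
    · simpa only [birkhoffSum_succ'] using
        le_max_of_le_right (add_le_add_right (hB ⟨n, rfl⟩) (f x))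
  · rintro ⟨B, hB⟩
    refine ⟨B - f x, ?_⟩
    rintro _ ⟨n, rfl⟩
    have hn : birkhoffSum T f (n + 1) x ≤ B := hB ⟨n + 1, rfl⟩
    rw [birkhoffSum_succ'] at hn
    exact le_sub_iff_add_le'.2 hn

/-- The maximum of the Birkhoff sums of lengths `0, …, n`, as in the maximal ergodic theorem. The
empty sum is included, so the maximum is nonnegative. -/
noncomputable def maxBirkhoffSum (T : Ω → Ω) (f : Ω → ℝ) (n : ℕ) (x : Ω) : ℝ :=
  partialSups (fun k => birkhoffSum T f k x) n

theorem maxBirkhoffSum_zero (T : Ω → Ω) (f : Ω → ℝ) (x : Ω) : maxBirkhoffSum T f 0 x = 0 := by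
  simp [maxBirkhoffSum]

theorem maxBirkhoffSum_succ (T : Ω → Ω) (f : Ω → ℝ) (n : ℕ) (x : Ω) :
    maxBirkhoffSum T f (n + 1) x = max 0 (f x + maxBirkhoffSum T f n (T x)) := by
  induction n with
  | zero =>
    rw [maxBirkhoffSum, partialSups_add_one, partialSups_zero, maxBirkhoffSum_zero]
    simp
  | succ n ih =>
    simp only [maxBirkhoffSum] at ih ⊢
    rw [partialSups_add_one, ih, partialSups_add_one, birkhoffSum_succ', max_assoc,
      max_add_add_left]

theorem monotone_maxBirkhoffSum (T : Ω → Ω) (f : Ω → ℝ) (x : Ω) :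
    Monotone fun n => maxBirkhoffSum T f n x :=
  (partialSups fun k => birkhoffSum T f k x).monotone

theorem maxBirkhoffSum_nonneg (T : Ω → Ω) (f : Ω → ℝ) (n : ℕ) (x : Ω) :
    0 ≤ maxBirkhoffSum T f n x :=
  (maxBirkhoffSum_zero T f x).ge.trans (monotone_maxBirkhoffSum T f x n.zero_le)

theorem tendsto_maxBirkhoffSum_atTop {x : Ω}
    (hx : ¬ BddAbove (Set.range fun n => birkhoffSum T f n x)) :
    Tendsto (fun n => maxBirkhoffSum T f n x) atTop atTop :=
  tendsto_atTop_atTop_of_monotone' (monotone_maxBirkhoffSum T f x)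
    (by simpa only [maxBirkhoffSum, bddAbove_range_partialSups] using hx)

theorem maxBirkhoffSum_succ_sub (T : Ω → Ω) (f : Ω → ℝ) (n : ℕ) (x : Ω) :
    maxBirkhoffSum T f (n + 1) x - maxBirkhoffSum T f n (T x) =
      max (-maxBirkhoffSum T f n (T x)) (f x) := by
  rw [maxBirkhoffSum_succ, ← max_sub_sub_right, zero_sub, add_sub_cancel_right]

theorem abs_maxBirkhoffSum_succ_sub_le (T : Ω → Ω) (f : Ω → ℝ) (n : ℕ) (x : Ω) :
    |maxBirkhoffSum T f (n + 1) x - maxBirkhoffSum T f n (T x)| ≤ |f x| := by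
  rw [maxBirkhoffSum_succ_sub, abs_le]
  have h0 := maxBirkhoffSum_nonneg T f n (T x)
  exact ⟨(neg_abs_le _).trans (le_max_right _ _),
    max_le ((neg_nonpos.2 h0).trans (abs_nonneg _)) (le_abs_self _)⟩

variable [MeasurableSpace Ω] {μ : Measure Ω}

theorem integral_comp_eq_of_measurePreserving {α β E : Type*} [MeasurableSpace α]
    [MeasurableSpace β] [NormedAddCommGroup E] [NormedSpace ℝ E] {μ : Measure α} {ν : Measure β}
    {S : α → β} (hS : MeasurePreserving S μ ν) {g : β → E} (hg : AEStronglyMeasurable g ν) :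
    ∫ x, g (S x) ∂μ = ∫ y, g y ∂ν := by
  rw [← hS.map_eq] at hg ⊢
  exact (integral_map hS.measurable.aemeasurable hg).symm

theorem measurable_birkhoffSum (hT : Measurable T) (hf : Measurable f) (n : ℕ) :
    Measurable (birkhoffSum T f n) :=
  Finset.measurable_fun_sum _ fun k _ => hf.comp (hT.iterate k)

theorem integrable_maxBirkhoffSum (hT : MeasurePreserving T μ μ) (hf : Integrable f μ) (n : ℕ) :
    Integrable (maxBirkhoffSum T f n) μ := by
  induction n with
  | zero =>
    exact (integrable_zero Ω ℝ μ).congr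
      (ae_of_all _ fun x => (maxBirkhoffSum_zero T f x).symm)
  | succ n ih =>
    exact ((integrable_zero Ω ℝ μ).sup (hf.add (hT.integrable_comp_of_integrable ih))).congr
      (ae_of_all _ fun x => (maxBirkhoffSum_succ T f n x).symm)

theorem integral_maxBirkhoffSum_succ_sub_nonneg (hT : MeasurePreserving T μ μ)
    (hf : Integrable f μ) (n : ℕ) :
    0 ≤ ∫ x, (maxBirkhoffSum T f (n + 1) x - maxBirkhoffSum T f n (T x)) ∂μ := by
  have hn := integrable_maxBirkhoffSum hT hf n
  have hn' := integrable_maxBirkhoffSum hT hf (n + 1)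
  have hnT : Integrable (fun x => maxBirkhoffSum T f n (T x)) μ :=
    hT.integrable_comp_of_integrable hn
  rw [integral_sub hn' hnT,
    integral_comp_eq_of_measurePreserving hT hn.aestronglyMeasurable, sub_nonneg]
  exact integral_mono hn hn' fun x => monotone_maxBirkhoffSum T f x n.le_succ

theorem ae_bddAbove_birkhoffSum_of_integral_neg (hT : Ergodic T μ) (hfm : Measurable f)
    (hf : Integrable f μ) (hneg : ∫ x, f x ∂μ < 0) :
    ∀ᵐ x ∂μ, BddAbove (Set.range fun n => birkhoffSum T f n x) := by
  -- Where the sums are unbounded, the increments `M (n + 1) - M n ∘ T` of the maximal sums are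
  -- eventually equal to `f`; but their integrals are nonnegative.
  refine (hT.toPreErgodic.ae_mem_or_ae_notMem
    (measurableSet_bddAbove_range (measurable_birkhoffSum hT.measurable hfm))
    (Set.ext (bddAbove_range_birkhoffSum_apply_iff T f))).resolve_right fun hunbdd => ?_
  have hlim : Tendsto
      (fun n => ∫ x, (maxBirkhoffSum T f (n + 1) x - maxBirkhoffSum T f n (T x)) ∂μ)
      atTop (𝓝 (∫ x, f x ∂μ)) := by
    refine tendsto_integral_of_dominated_convergence (fun x => |f x|) (fun n => ?_) hf.abs
      (fun n => ae_of_all _ (abs_maxBirkhoffSum_succ_sub_le T f n)) ?_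
    · exact ((integrable_maxBirkhoffSum hT.toMeasurePreserving hf (n + 1)).sub
        (hT.integrable_comp_of_integrable
          (integrable_maxBirkhoffSum hT.toMeasurePreserving hf n))).aestronglyMeasurable
    · filter_upwards [hunbdd] with x hx
      have hTx := tendsto_maxBirkhoffSum_atTop
        ((bddAbove_range_birkhoffSum_apply_iff T f x).not.2 hx)
      refine tendsto_const_nhds.congr' ?_
      filter_upwards [hTx.eventually_ge_atTop (-f x)] with n hn
      rw [maxBirkhoffSum_succ_sub, max_eq_right (neg_le.1 hn)]
  exact hneg.not_ge (ge_of_tendsto' hlim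
    (integral_maxBirkhoffSum_succ_sub_nonneg hT.toMeasurePreserving hf))

variable [IsProbabilityMeasure μ]

theorem ae_eventually_birkhoffAverage_lt (hT : Ergodic T μ) (hfm : Measurable f)
    (hf : Integrable f μ) :
    ∀ᵐ x ∂μ, ∀ a > ∫ y, f y ∂μ, ∀ᶠ n in atTop, birkhoffAverage ℝ T f n x < a := by
  have hbdd (q : ℚ) (hq : ∫ y, f y ∂μ < q) :
      ∀ᵐ x ∂μ, BddAbove (Set.range fun n => birkhoffSum T (fun y => f y - q) n x) := by
    refine ae_bddAbove_birkhoffSum_of_integral_neg hT (hfm.sub_const _)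
      (hf.sub (integrable_const _)) ?_
    rw [integral_sub hf (integrable_const _), integral_const, probReal_univ, one_smul]
    exact sub_neg.2 hq
  have hbdd' : ∀ᵐ x ∂μ, ∀ q : ℚ, ∫ y, f y ∂μ < q →
      BddAbove (Set.range fun n => birkhoffSum T (fun y => f y - q) n x) := by
    refine ae_all_iff.2 fun q => ?_
    by_cases hq : ∫ y, f y ∂μ < q
    · exact (hbdd q hq).mono fun x hx _ => hx
    · exact ae_of_all _ fun x h => absurd h hq
  filter_upwards [hbdd'] with x hx a ha
  obtain ⟨q, hq, hqa⟩ := exists_rat_btwn ha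
  obtain ⟨B, hB⟩ := hx q hq
  have hlim : Tendsto (fun n : ℕ => B / n + q) atTop (𝓝 (0 + q)) :=
    (tendsto_const_div_atTop_nhds_zero_nat B).add_const _
  rw [zero_add] at hlim
  filter_upwards [hlim.eventually_lt_const hqa, eventually_gt_atTop 0] with n hn hn0
  refine lt_of_le_of_lt ?_ hn
  have hn0' : (0 : ℝ) < n := Nat.cast_pos.2 hn0
  have hsum : birkhoffSum T f n x - n * q ≤ B := by
    simpa [birkhoffSum, Finset.sum_sub_distrib] using hB ⟨n, rfl⟩
  rw [birkhoffAverage, smul_eq_mul, inv_mul_eq_div, div_add' _ _ _ hn0'.ne']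
  gcongr
  linarith

theorem tendsto_birkhoffAverage_of_ergodic (hT : Ergodic T μ) (hf : Integrable f μ) :
    ∀ᵐ x ∂μ, Tendsto (fun n => birkhoffAverage ℝ T f n x) atTop (𝓝 (∫ y, f y ∂μ)) := by
  wlog hfm : Measurable f generalizing f
  · have hmk := hf.aestronglyMeasurable.ae_eq_mk
    have havg := ae_all_iff.2 fun n =>
      hT.quasiMeasurePreserving.birkhoffAverage_ae_eq_of_ae_eq ℝ hmk n
    filter_upwards [havg, this (hf.congr hmk) hf.aestronglyMeasurable.measurable_mk] with x hx hlim
    rw [integral_congr_ae hmk]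
    exact hlim.congr fun n => (hx n).symm
  filter_upwards [ae_eventually_birkhoffAverage_lt hT hfm hf,
    ae_eventually_birkhoffAverage_lt hT hfm.neg hf.neg] with x hupper hlower
  refine tendsto_order.2 ⟨fun a ha => ?_, hupper⟩
  have hneg := hlower (-a) (by simpa only [Pi.neg_apply, integral_neg, gt_iff_lt, neg_lt_neg_iff])
  filter_upwards [hneg] with n hn
  simpa only [birkhoffAverage_neg, Pi.neg_apply, neg_lt_neg_iff] using hn

end ErgodicTheorem


section Trimming

variable {Ω : Type*} {T : Ω → Ω} {χ : Ω → ℝ} {b n : ℕ} {l : ℝ} {x : Ω}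

theorem antitone_comp_sort_neg (g : Fin n → ℝ) : Antitone (g ∘ Tuple.sort fun j => -g j) :=
  fun _ _ hij => neg_le_neg_iff.1 (Tuple.monotone_sort (fun j => -g j) hij)

theorem exists_antitone_orbit_rearrangement (T : Ω → Ω) (χ : Ω → ℝ) (n : ℕ) (x : Ω) :
    ∃ y : Fin n → Ω, Antitone (χ ∘ y) ∧
      (∀ g : Ω → ℝ, birkhoffSum T g n x = ∑ k, g (y k)) ∧
      ∀ b, trimmedSum T χ b n x = ∑ k with b ≤ k.val, χ (y k) := by
  let σ := Tuple.sort fun j : Fin n => -χ (T^[(j : ℕ)] x)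
  refine ⟨fun k => T^[(σ k : ℕ)] x,
    antitone_comp_sort_neg fun j : Fin n => χ (T^[(j : ℕ)] x), fun g => ?_, fun b => rfl⟩
  rw [Equiv.sum_comp σ fun j => g (T^[(j : ℕ)] x),
    Fin.sum_univ_eq_sum_range fun j => g (T^[j] x), birkhoffSum]

theorem trimmedSum_le_birkhoffSum_indicator_le (h0 : ∀ y, 0 ≤ χ y)
    (hb : birkhoffSum T ({y | l < χ y}.indicator 1) n x ≤ (b : ℝ)) :
    trimmedSum T χ b n x ≤ birkhoffSum T ({y | χ y ≤ l}.indicator χ) n x := by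
  obtain ⟨y, hanti, hsum, htrim⟩ := exists_antitone_orbit_rearrangement T χ n x
  have hle (k : Fin n) (hk : b ≤ k.val) : χ (y k) ≤ l := by
    by_contra! hlt
    have hcard : ((k.val + 1 : ℕ) : ℝ) ≤ b := calc
      ((k.val + 1 : ℕ) : ℝ) = ∑ i ∈ Finset.Iic k, {y | l < χ y}.indicator (1 : Ω → ℝ) (y i) := by
        rw [← Fin.card_Iic, Finset.card_eq_sum_ones, Nat.cast_sum, Nat.cast_one]
        refine Finset.sum_congr rfl fun i hi => ?_
        rw [Set.indicator_of_mem (show y i ∈ {y | l < χ y} from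
          hlt.trans_le (hanti (Finset.mem_Iic.1 hi))), Pi.one_apply]
      _ ≤ ∑ i, {y | l < χ y}.indicator (1 : Ω → ℝ) (y i) :=
        Finset.sum_le_univ_sum_of_nonneg fun i =>
          Set.indicator_nonneg (fun _ _ => zero_le_one) (y i)
      _ ≤ b := (hsum _).ge.trans hb
    exact absurd (Nat.cast_le.1 hcard) (by omega)
  rw [htrim, hsum]
  calc ∑ k with b ≤ k.val, χ (y k)
      = ∑ k with b ≤ k.val, {y | χ y ≤ l}.indicator χ (y k) :=
        Finset.sum_congr rfl fun k hk =>
          (Set.indicator_of_mem (s := {y | χ y ≤ l}) (hle k (Finset.mem_filter.1 hk).2) χ).symm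
    _ ≤ ∑ k, {y | χ y ≤ l}.indicator χ (y k) :=
        Finset.sum_le_univ_sum_of_nonneg fun k => Set.indicator_nonneg (fun z _ => h0 z) (y k)

theorem birkhoffSum_min_le_trimmedSum_add (hl : 0 ≤ l) :
    birkhoffSum T (fun y => min (χ y) l) n x ≤ trimmedSum T χ b n x + b * l := by
  obtain ⟨y, -, hsum, htrim⟩ := exists_antitone_orbit_rearrangement T χ n x
  have hcard : (Finset.univ.filter fun k : Fin n => ¬ b ≤ k.val).card ≤ b := by
    simp only [not_le, Fin.card_filter_val_lt, min_le_right]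
  rw [hsum, htrim, ← Finset.sum_filter_add_sum_filter_not _ fun k : Fin n => b ≤ k.val]
  refine add_le_add (Finset.sum_le_sum fun k _ => min_le_left _ _) ?_
  calc ∑ k : Fin n with ¬ b ≤ k.val, min (χ (y k)) l
      ≤ (Finset.univ.filter fun k : Fin n => ¬ b ≤ k.val).card • l :=
        Finset.sum_le_card_nsmul _ _ _ fun k _ => min_le_right _ _
    _ ≤ b * l := by
        rw [nsmul_eq_mul]
        gcongr

variable [MeasurableSpace Ω]

theorem measurable_trimmedSum (hT : Measurable T) (hχ : Measurable χ) (b n : ℕ) :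
    Measurable (trimmedSum T χ b n) := by
  have horbit (j : ℕ) : Measurable fun x => χ (T^[j] x) := hχ.comp (hT.iterate j)
  let A (σ : Equiv.Perm (Fin n)) : Set Ω := {x | Antitone fun k => χ (T^[(σ k : ℕ)] x)}
  let S (σ : Equiv.Perm (Fin n)) (x : Ω) : ℝ := ∑ k : Fin n with b ≤ k.val, χ (T^[(σ k : ℕ)] x)
  have hA (σ) : MeasurableSet (A σ) := by
    simp only [A, Antitone, Set.ofPred_forall]
    exact .iInter fun i => .iInter fun j => .iInter fun _ => measurableSet_le (horbit _) (horbit _)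
  have hS (σ) : Measurable (S σ) := Finset.measurable_fun_sum _ fun k _ => horbit _
  intro s hs
  have hpre : trimmedSum T χ b n ⁻¹' s = ⋃ σ, A σ ∩ S σ ⁻¹' s := by
    ext x
    simp only [Set.mem_iUnion, Set.mem_inter_iff, Set.mem_preimage]
    constructor
    · intro hx
      exact ⟨_, antitone_comp_sort_neg fun j : Fin n => χ (T^[(j : ℕ)] x), hx⟩
    · rintro ⟨σ, hσ, hx⟩
      rwa [trimmedSum_eq T χ b n x σ hσ]
  rw [hpre]
  exact .iUnion fun σ => (hA σ).inter (hS σ hs)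

end Trimming

section Diagonal

theorem exists_tendsto_atTop_eventually_comp_le (N : ℕ → ℕ) :
    ∃ J : ℕ → ℕ, Tendsto J atTop atTop ∧ ∀ᶠ n in atTop, N (J n) ≤ n := by
  refine ⟨fun n => Nat.findGreatest (fun j => N j ≤ n) n, tendsto_atTop.2 fun j => ?_, ?_⟩
  · filter_upwards [eventually_ge_atTop j, eventually_ge_atTop (N j)] with n hjn hNn
    exact Nat.le_findGreatest hjn hNn
  · filter_upwards [eventually_ge_atTop (N 0)] with n hn
    exact Nat.findGreatest_spec (P := fun j => N j ≤ n) n.zero_le hn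

variable {Ω : Type*} [MeasurableSpace Ω] {μ : Measure Ω} [IsFiniteMeasure μ]

theorem exists_measure_iUnion_ge_compl_lt {G : ℕ → Set Ω} (hG : ∀ n, NullMeasurableSet (G n) μ)
    (h : ∀ᵐ x ∂μ, ∀ᶠ n in atTop, x ∈ G n) {ε : ℝ≥0∞} (hε : 0 < ε) :
    ∃ N, μ (⋃ n ≥ N, (G n)ᶜ) < ε := by
  have hnull : μ (⋂ N, ⋃ n ≥ N, (G n)ᶜ) = 0 := by
    rw [measure_eq_zero_iff_ae_notMem]
    filter_upwards [h] with x hx hmem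
    obtain ⟨N, hN⟩ := eventually_atTop.1 hx
    obtain ⟨n, hn, hxn⟩ := Set.mem_iUnion₂.1 (Set.mem_iInter.1 hmem N)
    exact hxn (hN n hn)
  have hlim := tendsto_measure_iInter_atTop (μ := μ) (s := fun N => ⋃ n ≥ N, (G n)ᶜ)
    (fun N => .iUnion fun n => .iUnion fun _ => (hG n).compl)
    (fun N N' hN => Set.biUnion_subset_biUnion_left fun n hn => le_trans hN hn)
    ⟨0, measure_ne_top _ _⟩
  rw [hnull] at hlim
  exact (hlim.eventually_lt_const hε).exists

theorem exists_tendsto_atTop_ae_eventually_mem {G : ℕ → ℕ → Set Ω}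
    (hG : ∀ j n, NullMeasurableSet (G j n) μ)
    (h : ∀ j, ∀ᵐ x ∂μ, ∀ᶠ n in atTop, x ∈ G j n) :
    ∃ J : ℕ → ℕ, Tendsto J atTop atTop ∧ ∀ᵐ x ∂μ, ∀ᶠ n in atTop, x ∈ G (J n) n := by
  obtain ⟨ε, hε, hsum⟩ := ENNReal.exists_pos_sum_of_countable' one_ne_zero ℕ
  choose N hN using fun j => exists_measure_iUnion_ge_compl_lt (hG j) (h j) (hε j)
  obtain ⟨J, hJ, hNJ⟩ := exists_tendsto_atTop_eventually_comp_le N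
  have hBC : ∀ᵐ x ∂μ, ∀ᶠ j in atTop, x ∉ ⋃ n ≥ N j, (G j n)ᶜ :=
    ae_eventually_notMem (ne_top_of_le_ne_top hsum.ne_top (ENNReal.tsum_le_tsum fun j => (hN j).le))
  refine ⟨J, hJ, hBC.mono fun x hx => ?_⟩
  filter_upwards [hJ.eventually hx, hNJ] with n hn hNn
  by_contra hxn
  exact hn (Set.mem_iUnion₂.2 ⟨n, hNn, hxn⟩)

end Diagonal

section Levels

variable {Ω : Type*} {χ : Ω → ℝ}

theorem min_eq_indicator_le_add_indicator_lt (χ : Ω → ℝ) (l : ℝ) :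
    (fun y => min (χ y) l) =
      fun y => {y | χ y ≤ l}.indicator χ y + {y | l < χ y}.indicator (1 : Ω → ℝ) y * l := by
  funext y
  rcases le_or_gt (χ y) l with h | h
  · simp [h, h.not_gt]
  · simp [h, h.le, h.not_ge]

variable [MeasurableSpace Ω] {μ : Measure Ω} [IsFiniteMeasure μ]

theorem integrable_indicator_le (hχ : Measurable χ) (h0 : ∀ y, 0 ≤ χ y) (l : ℝ) :
    Integrable ({y | χ y ≤ l}.indicator χ) μ := by
  refine (integrable_indicator_iff (measurableSet_le hχ measurable_const)).2 ?_
  refine Measure.integrableOn_of_bounded (measure_ne_top μ _) hχ.aestronglyMeasurable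
    (M := l) ?_
  filter_upwards [ae_restrict_mem (measurableSet_le hχ measurable_const)] with y hy
  rwa [Real.norm_of_nonneg (h0 y)]

theorem integrable_indicator_lt (hχ : Measurable χ) (l : ℝ) :
    Integrable ({y | l < χ y}.indicator (1 : Ω → ℝ)) μ :=
  (integrable_const 1).indicator (measurableSet_lt measurable_const hχ)

theorem integrable_min_const (hχ : Measurable χ) (h0 : ∀ y, 0 ≤ χ y) (l : ℝ) :
    Integrable (fun y => min (χ y) l) μ := by
  rw [min_eq_indicator_le_add_indicator_lt]
  exact (integrable_indicator_le hχ h0 l).add ((integrable_indicator_lt hχ l).mul_const l)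

theorem integral_min_const (hχ : Measurable χ) (h0 : ∀ y, 0 ≤ χ y) (l : ℝ) :
    ∫ y, min (χ y) l ∂μ =
      ∫ y, {y | χ y ≤ l}.indicator χ y ∂μ + μ.real {y | l < χ y} * l := by
  rw [min_eq_indicator_le_add_indicator_lt, integral_add (integrable_indicator_le hχ h0 l)
    ((integrable_indicator_lt hχ l).mul_const l), integral_mul_const,
    integral_indicator_one (measurableSet_lt measurable_const hχ)]

theorem tendsto_measureReal_lt_atTop (hχ : Measurable χ) :
    Tendsto (fun l => μ.real {y | l < χ y}) atTop (𝓝 0) := by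
  have h := tendsto_measure_iInter_atTop (μ := μ) (s := fun l : ℝ => {y | l < χ y})
    (fun l => (measurableSet_lt measurable_const hχ).nullMeasurableSet)
    (fun _ _ hl y hy => lt_of_le_of_lt hl hy) ⟨0, measure_ne_top _ _⟩
  have hempty : ⋂ l : ℝ, {y | l < χ y} = ∅ :=
    Set.eq_empty_of_forall_notMem fun y hy => lt_irrefl (χ y) (Set.mem_iInter.1 hy (χ y))
  rw [hempty, measure_empty] at h
  exact (ENNReal.tendsto_toReal_zero_iff fun _ => measure_ne_top _ _).2 h

theorem eventually_integral_indicator_le_pos (hχ : Measurable χ) (h0 : ∀ y, 0 ≤ χ y)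
    (hne : ¬ χ =ᵐ[μ] 0) :
    ∀ᶠ l in atTop, 0 < ∫ y, {y | χ y ≤ l}.indicator χ y ∂μ := by
  have hsupp : ⋃ l : ℝ, Function.support ({y | χ y ≤ l}.indicator χ) = Function.support χ := by
    simp only [Set.support_indicator, ← Set.iUnion_inter]
    exact Set.inter_eq_right.2 fun y _ => Set.mem_iUnion.2 ⟨χ y, le_refl (χ y)⟩
  have hmono : Monotone fun l : ℝ => Function.support ({y | χ y ≤ l}.indicator χ) := by
    intro l l' hl
    simp only [Set.support_indicator]
    exact Set.inter_subset_inter_left _ fun y hy => le_trans hy hl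
  have hlim := tendsto_measure_iUnion_atTop (μ := μ) hmono
  rw [hsupp] at hlim
  have hpos : 0 < μ (Function.support χ) :=
    pos_iff_ne_zero.2 fun h => hne (ae_iff.2 h)
  filter_upwards [hlim.eventually_const_lt hpos] with l hl
  exact (integral_pos_iff_support_of_nonneg (Set.indicator_nonneg fun y _ => h0 y)
    (integrable_indicator_le hχ h0 l)).2 hl

end Levels

section TrimmedAverages

theorem exists_pos_tendsto_natCast_div {a : ℝ} (ha : 0 < a) :
    ∃ b : ℕ → ℕ, (∀ n, 0 < b n) ∧ Tendsto b atTop atTop ∧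
      Tendsto (fun n => (b n : ℝ) / n) atTop (𝓝 a) := by
  have hfloor : Tendsto (fun n : ℕ => ⌊a * n⌋₊) atTop atTop :=
    tendsto_nat_floor_atTop.comp (tendsto_natCast_atTop_atTop.const_mul_atTop ha)
  refine ⟨fun n => ⌊a * n⌋₊ + 1, fun n => Nat.succ_pos _,
    tendsto_atTop_mono (fun n => Nat.le_succ _) hfloor, ?_⟩
  have h := ((tendsto_nat_floor_mul_div_atTop ha.le).comp
    (tendsto_natCast_atTop_atTop (R := ℝ))).add tendsto_one_div_atTop_nhds_zero_nat
  simpa only [Function.comp_def, add_zero, ← add_div, Nat.cast_add_one] using h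

variable {Ω : Type*} [MeasurableSpace Ω] {μ : Measure Ω} [IsProbabilityMeasure μ] {T : Ω → Ω}
  {χ : Ω → ℝ} {l δ : ℝ}

theorem ae_eventually_trimmedSum_div_mem_Ioo (hT : Ergodic T μ) (hχ : Measurable χ)
    (h0 : ∀ y, 0 ≤ χ y) (hl : 0 ≤ l) {a u v : ℝ} (ha : μ.real {y | l < χ y} < a) {b : ℕ → ℕ}
    (hb : Tendsto (fun n => (b n : ℝ) / n) atTop (𝓝 a)) (hu : u < ∫ y, min (χ y) l ∂μ - a * l)
    (hv : ∫ y, {y | χ y ≤ l}.indicator χ y ∂μ < v) :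
    ∀ᵐ x ∂μ, ∀ᶠ n : ℕ in atTop, trimmedSum T χ (b n) n x / n ∈ Set.Ioo u v := by
  have hexc : ∫ y, {y | l < χ y}.indicator (1 : Ω → ℝ) y ∂μ < a := by
    rwa [integral_indicator_one (measurableSet_lt measurable_const hχ)]
  filter_upwards [tendsto_birkhoffAverage_of_ergodic hT (integrable_indicator_le hχ h0 l),
    tendsto_birkhoffAverage_of_ergodic hT (integrable_indicator_lt hχ l),
    tendsto_birkhoffAverage_of_ergodic hT (integrable_min_const hχ h0 l)] with x htrunc hcount hmin
  filter_upwards [htrunc.eventually_lt_const hv, hcount.eventually_lt hb hexc,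
    (hmin.sub (hb.mul_const l)).eventually_const_lt hu, eventually_gt_atTop 0]
    with n hvn hcountn hun hn
  have hn' : (0 : ℝ) < n := Nat.cast_pos.2 hn
  simp only [birkhoffAverage, smul_eq_mul, inv_mul_eq_div] at hvn hcountn hun
  constructor
  · refine hun.trans_le ?_
    rw [div_mul_eq_mul_div, ← sub_div]
    gcongr
    exact sub_le_iff_le_add.2 (birkhoffSum_min_le_trimmedSum_add hl)
  · refine lt_of_le_of_lt ?_ hvn
    gcongr
    exact trimmedSum_le_birkhoffSum_indicator_le h0 ((div_lt_div_iff_of_pos_right hn').1 hcountn).le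

theorem exists_ae_eventually_abs_trimmedSum_div_sub_one_lt (hT : Ergodic T μ) (hχ : Measurable χ)
    (h0 : ∀ y, 0 ≤ χ y) (hne : ¬ χ =ᵐ[μ] 0) (hδ : 0 < δ) :
    ∃ (b : ℕ → ℕ) (m : ℝ), (∀ n, 0 < b n) ∧ Tendsto b atTop atTop ∧
      (∀ᶠ n in atTop, (b n : ℝ) ≤ δ * n) ∧ 0 < m ∧
      ∀ᵐ x ∂μ, ∀ᶠ n in atTop, |trimmedSum T χ (b n) n x / (n * m) - 1| < δ := by
  obtain ⟨l, hm, hpδ, hl⟩ := ((eventually_integral_indicator_le_pos hχ h0 hne).and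
    (((tendsto_measureReal_lt_atTop (μ := μ) hχ).eventually_lt_const hδ).and
      (eventually_gt_atTop 0))).exists
  set m := ∫ y, {y | χ y ≤ l}.indicator χ y ∂μ with hm_def
  set p := μ.real {y | l < χ y}
  obtain ⟨a, hpa, ha⟩ : ∃ a, p < a ∧ a < min δ (p + δ * m / l) :=
    exists_between (lt_min hpδ (lt_add_of_pos_right p (by positivity)))
  have ha0 : 0 < a := measureReal_nonneg.trans_lt hpa
  have hal : a * l < p * l + δ * m := by
    have := mul_lt_mul_of_pos_right (ha.trans_le (min_le_right _ _)) hl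
    rwa [add_mul, div_mul_cancel₀ _ hl.ne'] at this
  obtain ⟨b, hbpos, hbtop, hb⟩ := exists_pos_tendsto_natCast_div ha0
  refine ⟨b, m, hbpos, hbtop, ?_, hm, ?_⟩
  · filter_upwards [hb.eventually_lt_const (ha.trans_le (min_le_left _ _)), eventually_gt_atTop 0]
      with n hn hn0
    exact ((div_lt_iff₀ (Nat.cast_pos.2 hn0)).1 hn).le
  · filter_upwards [ae_eventually_trimmedSum_div_mem_Ioo hT hχ h0 hl.le hpa hb
      (u := m * (1 - δ)) (v := m * (1 + δ))
      (by rw [integral_min_const hχ h0, ← hm_def]; linarith)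
      (lt_mul_of_one_lt_right hm (lt_add_of_pos_right 1 hδ))] with x hx
    filter_upwards [hx] with n hn
    rw [← div_div, abs_sub_lt_iff, sub_lt_iff_lt_add', sub_lt_comm, div_lt_iff₀' hm,
      lt_div_iff₀' hm]
    exact ⟨hn.2, hn.1⟩

end TrimmedAverages

theorem IsMixing.ergodic {Ω : Type*} [MeasurableSpace Ω] {μ : Measure Ω} [IsProbabilityMeasure μ]
    {T : Ω → Ω} (hmix : IsMixing μ T) (hT : MeasurePreserving T μ μ) : Ergodic T μ := by
  refine ⟨hT, ⟨fun A hA hinv => ?_⟩⟩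
  have hiter (n : ℕ) : A ∩ T^[n] ⁻¹' A = A := by
    rw [Set.preimage_iterate_eq, (Function.IsFixedPt.iterate hinv n).eq, Set.inter_self]
  have hlim := hmix A A hA hA
  simp only [hiter] at hlim
  have hsq : μ A = μ A * μ A := tendsto_nhds_unique tendsto_const_nhds hlim
  rw [eventuallyConst_set', ae_eq_empty, ae_eq_univ_iff_measure_eq hA.nullMeasurableSet,
    measure_univ]
  rcases eq_or_ne (μ A) 0 with h | h
  · exact .inl h
  · exact .inr ((ENNReal.mul_eq_left h (measure_ne_top μ A)).1 hsq.symm)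

theorem corollary1p3_general {Ω : Type*} [MeasurableSpace Ω] {μ : Measure Ω}
    [IsProbabilityMeasure μ] {T : Ω → Ω} {χ : Ω → ℝ} (hT : Ergodic T μ) (hχ : Measurable χ)
    (h0 : ∀ x, 0 ≤ χ x) (hne : ¬ χ =ᵐ[μ] 0) :
    ∃ (b : ℕ → ℕ) (d : ℕ → ℝ),
      (∀ n, 0 < b n) ∧ Tendsto b atTop atTop ∧
      (fun n => (b n : ℝ)) =o[atTop] (fun n => (n : ℝ)) ∧
      (∀ n, 0 < d n) ∧
      ∀ᵐ x ∂μ, Tendsto (fun n => trimmedSum T χ (b n) n x / d n) atTop (𝓝 1) := by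
  let δ (j : ℕ) : ℝ := 1 / (j + 1)
  choose β m hβpos hβtop hβδ hm hratio using fun j =>
    exists_ae_eventually_abs_trimmedSum_div_sub_one_lt hT hχ h0 hne (δ := δ j)
      Nat.one_div_pos_of_nat
  -- The bounds on `β j n` belong to the event so that the diagonal sequence inherits them.
  let G (j n : ℕ) : Set Ω := {x | (j ≤ β j n ∧ (β j n : ℝ) ≤ δ j * n) ∧
    |trimmedSum T χ (β j n) n x / (n * m j) - 1| < δ j}
  have hG (j n : ℕ) : MeasurableSet (G j n) :=
    (MeasurableSet.const _).inter (measurableSet_lt ((((measurable_trimmedSum hT.measurable hχ _ n)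
      |>.div_const _).sub_const 1).abs) measurable_const)
  obtain ⟨J, hJ, hGJ⟩ := exists_tendsto_atTop_ae_eventually_mem
    (fun j n => (hG j n).nullMeasurableSet) fun j => (hratio j).mono fun x hx =>
      (((hβtop j).eventually_ge_atTop j).and (hβδ j)).and hx
  have hδJ : Tendsto (fun n => δ (J n)) atTop (𝓝 0) :=
    tendsto_one_div_add_atTop_nhds_zero_nat.comp hJ
  obtain ⟨x₀, hx₀⟩ := hGJ.exists
  refine ⟨fun n => β (J n) n, fun n => max (n : ℝ) 1 * m (J n), fun n => hβpos _ n,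
    tendsto_atTop_mono' _ (hx₀.mono fun n hn => hn.1.1) hJ, ?_,
    fun n => mul_pos (lt_max_of_lt_right one_pos) (hm _), ?_⟩
  · refine isLittleO_iff.2 fun ε hε => ?_
    filter_upwards [hx₀, hδJ.eventually_lt_const hε] with n hn hδn
    rw [Real.norm_natCast, Real.norm_natCast]
    exact hn.1.2.trans (by gcongr)
  · filter_upwards [hGJ] with x hx
    refine tendsto_iff_norm_sub_tendsto_zero.2 (squeeze_zero' (.of_forall fun _ => norm_nonneg _)
      ?_ hδJ)
    filter_upwards [hx, eventually_ge_atTop 1] with n hn hn1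
    rw [max_eq_left (Nat.one_le_cast.2 hn1)]
    exact hn.2.le

end TrimmedBirkhoff

theorem corollary1p3 {Ω F : Type*} [MeasurableSpace Ω] (μ : Measure Ω) [IsProbabilityMeasure μ]
    (T : Ω → Ω) [NormedCommRing F] [NormedAlgebra ℂ F] [CompleteSpace F]
    (ι : F →ₗ[ℂ] (Ω →ₘ[μ] ℂ)) (χ : Ω → ℝ)
    (hD : TrimmedBirkhoff.PropertyD μ T ι χ) (hχ : ¬ χ =ᵐ[μ] 0) :
    ∃ (b : ℕ → ℕ) (d : ℕ → ℝ),
      (∀ n, 0 < b n) ∧ Tendsto b atTop atTop ∧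
      (fun n => (b n : ℝ)) =o[atTop] (fun n => (n : ℝ)) ∧
      (∀ n, 0 < d n) ∧
      ∀ᵐ x ∂μ,
        Tendsto (fun n => TrimmedBirkhoff.trimmedSum T χ (b n) n x / d n) atTop (𝓝 1) :=
  TrimmedBirkhoff.corollary1p3_general (hD.propertyC.mixing.ergodic hD.propertyC.measurePreserving)
    hD.measurable hD.nonneg hχ
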